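/- Let $\mathcal V=(\mathcal V_o,\otimes,e)$ be a commutative quantale: a complete lattice with a commutative monoid structure $(\otimes,e)$ such that $\otimes$ preserves arbitrary joins in each variable. Assume that $\mathcal V$ is non-trivial ($e\neq\bot$) and integral ($e=\top$). A (small) $\mathcal V$-category $X$ is a set of objects with homs $X(x',x)\in\mathcal V_o$ such that $e\le X(x,x)$ and $X(x',x)\otimes X(x'',x')\le X(x'',x)$; a $\mathcal V$-functor $f:X\to Y$ is a map on objects with $X(x',x)\le Y(fx',fx)$; $X$ is *discrete* if $X(x,x)=e$ and $X(x',x)=\bot$ for $x'\ne x$. Small $\mathcal V$-categories form the symmetric monoidal closed category $\mathcal V\text{-cat}$, with $[X,Y](f,g)=\bigwedge_x Y(fx,gx)$; functors, natural transformations, weighted colimits and (pointwise) left Kan extensions below are taken in the $\mathcal V\text{-cat}$-enriched sense. Let $D:\mathsf{Set}\to\mathcal V\text{-cat}$ send a set to the discrete $\mathcal V$-category on it, where $\mathsf{Set}$ is a $\mathcal V\text{-cat}$-category through the discrete $\mathcal V$-categories $D(\mathsf{Set}(A,B))$. Let $\mathbb N$ be the free $\mathcal V\text{-cat}$-category on the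 ordinary category whose objects are a symbol $\mathsf o$ and all $r\in\mathcal V_o$ and whose non-identity arrows are $\delta^r_0,\delta^r_1:r\to\mathsf o$ for each $r$. Let the weight $N:\mathbb N^{op}\to\mathcal V\text{-cat}$ send $\mathsf o$ to the unit $\mathcal V$-category $\mathbb 1$ (one object, with hom $e$) and $r$ to the $\mathcal V$-category $\mathbb 2_r$ with objects $0,1$ and $\mathbb 2_r(0,0)=\mathbb 2_r(1,1)=e$, $\mathbb 2_r(0,1)=r$, $\mathbb 2_r(1,0)=\bot$, with $N\delta^r_i:\mathbb 1\to\mathbb 2_r$ picking the object $i$. For a $\mathcal V$-category $X$ let $F_X:\mathbb N\to\mathsf{Set}$ send $\mathsf o$ to the set $X_{\mathsf o}$ of objects of $X$ and $r$ to $X_r=\{(x',x)\in X_{\mathsf o}\times X_{\mathsf o} : r\le X(x',x)\}$, with $F_X\delta^r_0$ and $F_X\delta^r_1$ the first and the second projection. **Theorem.** For every $\mathcal V\text{-cat}$-functor $G:\mathcal V\text{-cat}\to\mathcal V\text{-cat}$ the following are equivalent. 1. There is a functor $T:\mathsf{Set}\to\mathsf{Set}$ such that $G\cong\mathrm{Lan}_D(DT)$,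 i.e. $G$ is the $\mathcal V\text{-cat}$-ification of $T$. 2. For every $\mathcal V$-category $X$, $G$ preserves the colimit of $DF_X$ weighted by $N$; and $G$ sends discrete $\mathcal V$-categories to discrete $\mathcal V$-categories. -/

import Mathlib

/-!
Categories enriched in a commutative quantale `V` (tensor `*`, unit `1`), the symmetric monoidal
closed category `V-cat` of small `V`-categories, and categories enriched in `V-cat`, up to weighted
colimits and left Kan extensions.
-/

open CategoryTheory Opposite

universe v u u₁ u₂ u₃ w₁ w₂ w₃

noncomputable section

/-- A small `V`-category: a set of objects with a `V`-valued hom. -/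
structure VCat (V : Type v) [CompleteLattice V] [CommMonoid V] : Type (max v (u + 1)) where
  carrier : Type u
  hom : carrier → carrier → V
  one_le_hom (x : carrier) : 1 ≤ hom x x
  hom_mul_hom_le (x'' x' x : carrier) : hom x' x * hom x'' x' ≤ hom x'' x

instance {V : Type v} [CompleteLattice V] [CommMonoid V] : CoeSort (VCat.{v, u} V) (Type u) :=
  ⟨VCat.carrier⟩

/-- A `V`-functor: an object assignment `f` with `X(x', x) ≤ Y(f x', f x)`. -/
@[ext]
structure VFunctor {V : Type v} [CompleteLattice V] [CommMonoid V]
    (X : VCat.{v, u₁} V) (Y : VCat.{v, u₂} V) where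
  toFun : X → Y
  hom_le (x' x : X) : X.hom x' x ≤ Y.hom (toFun x') (toFun x)

instance {V : Type v} [CompleteLattice V] [CommMonoid V]
    (X : VCat.{v, u₁} V) (Y : VCat.{v, u₂} V) : CoeFun (VFunctor X Y) (fun _ => X → Y) :=
  ⟨VFunctor.toFun⟩

/-- The ordinary category of small `V`-categories and `V`-functors. -/
instance VCat.category (V : Type v) [CompleteLattice V] [CommMonoid V] :
    Category.{u} (VCat.{v, u} V) where
  Hom X Y := VFunctor X Y
  id X := ⟨fun x => x, fun _ _ => le_rfl⟩
  comp f g := ⟨fun x => g (f x), fun _ _ => (f.hom_le _ _).trans (g.hom_le _ _)⟩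

/-- A map of objects that is an isomorphism of `V`-categories (the two `V`-categories may live in
different universes): bijective on objects and equal on homs. -/
def IsVCatIso {V : Type v} [CompleteLattice V] [CommMonoid V]
    {X : VCat.{v, u₁} V} {Y : VCat.{v, u₂} V} (f : X → Y) : Prop :=
  Function.Bijective f ∧ ∀ x' x : X, Y.hom (f x') (f x) = X.hom x' x

/-- A `V`-category is discrete if `X(x', x)` is `e` for `x' = x` and `⊥` otherwise. -/
def VCat.IsDiscrete {V : Type v} [CompleteLattice V] [CommMonoid V] (X : VCat.{v, u} V) : Prop :=
  (∀ x : X, X.hom x x = 1) ∧ ∀ x' x : X, x' ≠ x → X.hom x' x = ⊥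

open Classical in
/-- The discrete `V`-category on a set. -/
def VCat.disc (V : Type v) [CompleteLattice V] [CommMonoid V] [IsQuantale V] (S : Type u) :
    VCat.{v, u} V where
  carrier := S
  hom x' x := if x' = x then 1 else ⊥
  one_le_hom x := by simp
  hom_mul_hom_le x'' x' x := by
    by_cases h₁ : x' = x
    · subst h₁; simp
    · simp [h₁]

/-- The two-object `V`-category `2_r` on `{0, 1}` (`false` is `0` and `true` is `1`), with
`2_r(0,0) = 2_r(1,1) = e`, `2_r(0,1) = r` and `2_r(1,0) = ⊥`. -/
def VCat.two {V : Type v} [CompleteLattice V] [CommMonoid V] [IsQuantale V] (r : V) :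
    VCat.{v, u} V where
  carrier := ULift.{u} Bool
  hom
    | ⟨false⟩, ⟨true⟩ => r
    | ⟨true⟩, ⟨false⟩ => ⊥
    | ⟨false⟩, ⟨false⟩ => 1
    | ⟨true⟩, ⟨true⟩ => 1
  one_le_hom := by rintro ⟨_ | _⟩ <;> exact le_rfl
  hom_mul_hom_le := by
    rintro ⟨_ | _⟩ ⟨_ | _⟩ ⟨_ | _⟩ <;> simp [Quantale.bot_mul, Quantale.mul_bot]

/-! ### Categories enriched in `V-cat` -/

/-- A `V-cat`-category. A `V`-category of arrows `C(X, Y)` for all `X`, `Y` whose objects are the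
arrows `X ⟶ Y` of an ordinary category; the composition `C(Y, Z) ⊗ C(X, Y) ⟶ C(X, Z)` is a
`V`-functor. (Unit and associativity axioms are equalities of `V`-functors, hence of object
assignments: they are the axioms of the ordinary category.) -/
class VCatCategory (V : Type v) [CompleteLattice V] [CommMonoid V]
    (C : Type u₁) [Category.{w₁} C] where
  homDist {X Y : C} : (X ⟶ Y) → (X ⟶ Y) → V
  one_le_homDist {X Y : C} (f : X ⟶ Y) : 1 ≤ homDist f f
  homDist_mul_le {X Y : C} (f'' f' f : X ⟶ Y) : homDist f' f * homDist f'' f' ≤ homDist f'' f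
  homDist_comp_le {X Y Z : C} (f f' : X ⟶ Y) (g g' : Y ⟶ Z) :
    homDist g g' * homDist f f' ≤ homDist (f ≫ g) (f' ≫ g')

namespace VCatCategory

/-- The `V`-category `C(X, Y)` of arrows of a `V-cat`-category. -/
def homObj (V : Type v) [CompleteLattice V] [CommMonoid V] {C : Type u₁} [Category.{w₁} C]
    [VCatCategory V C] (X Y : C) : VCat.{v, w₁} V where
  carrier := X ⟶ Y
  hom := homDist
  one_le_hom := one_le_homDist
  hom_mul_hom_le := homDist_mul_le

open Classical in
/-- The free `V-cat`-category on an ordinary category: `C(X, Y)` is the discrete `V`-category on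
the set of arrows `X ⟶ Y`. -/
@[reducible]
def free (V : Type v) [CompleteLattice V] [CommMonoid V] [IsQuantale V]
    (C : Type u₁) [Category.{w₁} C] : VCatCategory V C where
  homDist {X Y} f g := (VCat.disc V (X ⟶ Y)).hom f g
  one_le_homDist {X Y} := (VCat.disc V (X ⟶ Y)).one_le_hom
  homDist_mul_le {X Y} := (VCat.disc V (X ⟶ Y)).hom_mul_hom_le
  homDist_comp_le f f' g g' := by
    by_cases hf : f = f'
    · by_cases hg : g = g'
      · subst hf hg; simp [VCat.disc]
      · simp [VCat.disc, hg]
    · simp [VCat.disc, hf, Quantale.mul_bot]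

/-- The category of sets, with the discrete (free) enrichment. -/
instance instType (V : Type v) [CompleteLattice V] [CommMonoid V] [IsQuantale V] :
    VCatCategory V (Type u) :=
  free V (Type u)

/-- The opposite `V-cat`-category. -/
instance instOpposite (V : Type v) [CompleteLattice V] [CommMonoid V]
    (C : Type u₁) [Category.{w₁} C] [VCatCategory V C] : VCatCategory V Cᵒᵖ where
  homDist f g := homDist f.unop g.unop
  one_le_homDist f := one_le_homDist f.unop
  homDist_mul_le f'' f' f := homDist_mul_le f''.unop f'.unop f.unop
  homDist_comp_le f f' g g' := by
    rw [mul_comm]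
    exact homDist_comp_le g.unop g'.unop f.unop f'.unop

/-- `V-cat` is enriched in itself by `[X, Y](f, g) = ⨅ x, Y(f x, g x)`. -/
instance instVCat (V : Type v) [CompleteLattice V] [CommMonoid V] [IsQuantale V] :
    VCatCategory V (VCat.{v, u} V) where
  homDist {X Y} f g := ⨅ x : X, Y.hom (f.toFun x) (g.toFun x)
  one_le_homDist {_ Y} f := le_iInf fun x => Y.one_le_hom (f.toFun x)
  homDist_mul_le {_ Y} _ f' _ := le_iInf fun x =>
    (mul_le_mul' (iInf_le _ x) (iInf_le _ x)).trans (Y.hom_mul_hom_le _ (f'.toFun x) _)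
  homDist_comp_le {_ _ Z} _ f' g _ := le_iInf fun x =>
    (mul_le_mul' (iInf_le _ (f'.toFun x)) ((iInf_le _ x).trans (g.hom_le _ _))).trans
      (Z.hom_mul_hom_le _ _ _)

end VCatCategory

open VCatCategory

/-- A `V-cat`-functor: a functor whose action on arrows `C(X, Y) → D(F X, F Y)` is a `V`-functor. -/
structure VCatFunctor (V : Type v) [CompleteLattice V] [CommMonoid V]
    (C : Type u₁) [Category.{w₁} C] [VCatCategory V C]
    (D : Type u₂) [Category.{w₂} D] [VCatCategory V D] extends C ⥤ D where
  homDist_le {X Y : C} (f g : X ⟶ Y) : homDist (V := V) f g ≤ homDist (V := V) (map f) (map g)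

namespace VCatFunctor

/-- Composition of `V-cat`-functors. -/
def comp {V : Type v} [CompleteLattice V] [CommMonoid V]
    {C : Type u₁} [Category.{w₁} C] [VCatCategory V C]
    {D : Type u₂} [Category.{w₂} D] [VCatCategory V D]
    {E : Type u₃} [Category.{w₃} E] [VCatCategory V E]
    (F : VCatFunctor V C D) (G : VCatFunctor V D E) : VCatFunctor V C E where
  toFunctor := F.toFunctor ⋙ G.toFunctor
  homDist_le f g := (F.homDist_le f g).trans (G.homDist_le _ _)

/-- Every ordinary functor out of `C` is a `V-cat`-functor out of the free `V-cat`-category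
on `C`. -/
def ofFree (V : Type v) [CompleteLattice V] [CommMonoid V] [IsQuantale V]
    {C : Type u₁} [Category.{w₁} C] {D : Type u₂} [Category.{w₂} D] [VCatCategory V D]
    (F : C ⥤ D) :
    letI : VCatCategory V C := VCatCategory.free V C
    VCatFunctor V C D :=
  letI : VCatCategory V C := VCatCategory.free V C
  { toFunctor := F
    homDist_le := fun f g => by
      classical
      change (if f = g then (1 : V) else ⊥) ≤ _
      split_ifs with h
      · subst h; exact one_le_homDist _
      · exact bot_le }

end VCatFunctor

/-! ### Weighted colimits and left Kan extensions

A `V-cat`-natural transformation is an ordinary natural transformation of the underlying functors,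
because there is nothing to check on homs. -/

section Colimits

variable {V : Type v} [CompleteLattice V] [CommMonoid V] [IsQuantale V]
variable {A : Type u₁} [Category.{w₁} A] [VCatCategory V A]
variable {B : Type u₂} [Category.{u} B] [VCatCategory V B]
variable {C : Type u₃} [Category.{u} C] [VCatCategory V C]

/-- The `V-cat`-functor `C(F -, X) : Aᵒᵖ → V-cat`. -/
def homPresheaf (F : VCatFunctor V A C) (X : C) : VCatFunctor V Aᵒᵖ (VCat.{v, u} V) where
  obj a := homObj V (F.obj a.unop) X
  map {a b} h :=
    { toFun := fun (k : F.obj a.unop ⟶ X) => F.map h.unop ≫ k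
      hom_le := fun (k k' : F.obj a.unop ⟶ X) => by
        have h₁ := homDist_comp_le (V := V) (F.map h.unop) (F.map h.unop) k k'
        refine le_trans ?_ h₁
        exact le_mul_of_one_le_right' (one_le_homDist _) }
  map_id a := VFunctor.ext (funext fun (k : F.obj a.unop ⟶ X) => by
    change F.map (𝟙 a.unop) ≫ k = k
    simp)
  map_comp {a b c} h h' := VFunctor.ext (funext fun (k : F.obj a.unop ⟶ X) => by
    change F.map (h'.unop ≫ h.unop) ≫ k = F.map h'.unop ≫ F.map h.unop ≫ k
    simp)
  homDist_le {a _} h h' := le_iInf fun (k : F.obj a.unop ⟶ X) => by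
    have h₁ := homDist_comp_le (V := V) (F.map h.unop) (F.map h'.unop) k k
    refine le_trans (F.homDist_le h.unop h'.unop) (le_trans ?_ h₁)
    exact le_mul_of_one_le_left' (one_le_homDist _)

/-- The natural transformation `C(F -, k) : C(F -, X) → C(F -, Y)` given by composition with
`k : X ⟶ Y`. -/
def homPresheafPostcomp (F : VCatFunctor V A C) {X Y : C} (k : X ⟶ Y) :
    (homPresheaf F X).toFunctor ⟶ (homPresheaf F Y).toFunctor where
  app a :=
    { toFun := fun (l : F.obj a.unop ⟶ X) => l ≫ k
      hom_le := fun (l l' : F.obj a.unop ⟶ X) => by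
        have h₁ := homDist_comp_le (V := V) l l' k k
        refine le_trans ?_ h₁
        exact le_mul_of_one_le_left' (one_le_homDist _) }
  naturality a b h := VFunctor.ext (funext fun (l : F.obj a.unop ⟶ X) =>
    Category.assoc (F.map h.unop) l k)

/-- The natural transformation `C(α, X) : C(F' -, X) → C(F -, X)` given by composition with
`α : F → F'`. -/
def homPresheafPrecomp {F F' : VCatFunctor V A C} (α : F.toFunctor ⟶ F'.toFunctor) (X : C) :
    (homPresheaf F' X).toFunctor ⟶ (homPresheaf F X).toFunctor where
  app a :=
    { toFun := fun (l : F'.obj a.unop ⟶ X) => α.app a.unop ≫ l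
      hom_le := fun (l l' : F'.obj a.unop ⟶ X) => by
        have h₁ := homDist_comp_le (V := V) (α.app a.unop) (α.app a.unop) l l'
        refine le_trans ?_ h₁
        exact le_mul_of_one_le_right' (one_le_homDist _) }
  naturality a b h := VFunctor.ext (funext fun (l : F'.obj a.unop ⟶ X) => by
    change α.app b.unop ≫ F'.map h.unop ≫ l = F.map h.unop ≫ α.app a.unop ≫ l
    simp)

/-- The natural transformation `B(F -, X) → C(G F -, G X)` given by the action of `G` on arrows. -/
def homPresheafMap (F : VCatFunctor V A B) (G : VCatFunctor V B C) (X : B) :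
    (homPresheaf F X).toFunctor ⟶ (homPresheaf (F.comp G) (G.obj X)).toFunctor where
  app a :=
    { toFun := fun (l : F.obj a.unop ⟶ X) => G.map l
      hom_le := fun (l l' : F.obj a.unop ⟶ X) => G.homDist_le l l' }
  naturality a _ h := VFunctor.ext (funext fun (l : F.obj a.unop ⟶ X) =>
    G.map_comp (F.map h.unop) l)

/-- The `V`-category `[Aᵒᵖ, V-cat](W, P)` of `V-cat`-natural transformations, with
`[Aᵒᵖ, V-cat](W, P)(τ, τ') = ⨅ a, [W a, P a](τ a, τ' a)`. -/
def natTransObj (W P : VCatFunctor V Aᵒᵖ (VCat.{v, u} V)) : VCat.{v, max u₁ u} V where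
  carrier := W.toFunctor ⟶ P.toFunctor
  hom τ τ' := ⨅ a : Aᵒᵖ, homDist (V := V) (τ.app a) (τ'.app a)
  one_le_hom τ := le_iInf fun a => one_le_homDist (τ.app a)
  hom_mul_hom_le τ'' τ' τ := le_iInf fun a =>
    (mul_le_mul' (iInf_le _ a) (iInf_le _ a)).trans
      (homDist_mul_le (τ''.app a) (τ'.app a) (τ.app a))

/-- `η : W → C(F -, L)` exhibits `L` as the colimit of `F` weighted by `W`: the induced maps
`C(L, Y) → [Aᵒᵖ, V-cat](W, C(F -, Y))`, which are `V-cat`-natural in `Y`, are isomorphisms of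
`V`-categories. (By the Yoneda lemma every `V-cat`-natural isomorphism of this kind is induced by
a unique `η`.) -/
def IsWeightedColimit (W : VCatFunctor V Aᵒᵖ (VCat.{v, u} V)) (F : VCatFunctor V A C) (L : C)
    (η : W.toFunctor ⟶ (homPresheaf F L).toFunctor) : Prop :=
  ∀ Y : C, IsVCatIso (X := homObj V L Y) (Y := natTransObj W (homPresheaf F Y))
    fun (k : L ⟶ Y) => η ≫ homPresheafPostcomp F k

/-- `G` preserves the colimit of the diagram `(W, F)`: whenever `η` exhibits `L` as the colimit of
`F` weighted by `W`, the image of `η` exhibits `G L` as the colimit of `G F` weighted by `W`. -/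
def PreservesWeightedColimit (G : VCatFunctor V B C)
    (W : VCatFunctor V Aᵒᵖ (VCat.{v, u} V)) (F : VCatFunctor V A B) : Prop :=
  ∀ (L : B) (η : W.toFunctor ⟶ (homPresheaf F L).toFunctor), IsWeightedColimit W F L η →
    IsWeightedColimit W (F.comp G) (G.obj L) (η ≫ homPresheafMap F G L)

/-- `α : H → K J` exhibits `K` as the `V-cat`-enriched (pointwise) left Kan extension of `H`
along `J`: for every `b`, the transformation `B(J -, b) → C(H -, K b)`, `f ↦ K f ∘ α`, exhibits
`K b` as the colimit of `H` weighted by `B(J -, b)`. -/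
def IsLeftKanExtension (J : VCatFunctor V A B) (H : VCatFunctor V A C) (K : VCatFunctor V B C)
    (α : H.toFunctor ⟶ (J.comp K).toFunctor) : Prop :=
  ∀ b : B, IsWeightedColimit (homPresheaf J b) H (K.obj b)
    (homPresheafMap J K b ≫ homPresheafPrecomp α (K.obj b))

end Colimits

/-! ### The discrete functor and the nerve diagrams -/

/-- The discrete functor `D : Set → V-cat`. -/
def discreteFunctor (V : Type v) [CompleteLattice V] [CommMonoid V] [IsQuantale V] :
    VCatFunctor V (Type u) (VCat.{v, u} V) :=
  VCatFunctor.ofFree V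
    { obj := fun S => VCat.disc V S
      map := fun {S S'} f =>
        { toFun := fun (x : S) => (f x : S')
          hom_le := fun (x' x : S) => by
            by_cases h : x' = x
            · subst h; simp [VCat.disc]
            · simp [VCat.disc, h] } }

/-- The objects of the ordinary category `N`: one object for each `r` in `V`, and one further
object `pt`. -/
inductive NerveIndex (V : Type v) : Type v
  | pt : NerveIndex V
  | lvl (r : V) : NerveIndex V

namespace NerveIndex

/-- The arrows of `N`: identities, and `δ₀, δ₁ : r ⟶ pt` for each `r`. -/
inductive Hom {V : Type v} : NerveIndex V → NerveIndex V → Type v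
  | id (a : NerveIndex V) : Hom a a
  | δ₀ (r : V) : Hom (lvl r) pt
  | δ₁ (r : V) : Hom (lvl r) pt

/-- Composition in `N`. -/
def Hom.comp {V : Type v} : {a b c : NerveIndex V} → Hom a b → Hom b c → Hom a c
  | _, _, _, .id _, g => g
  | _, _, _, .δ₀ r, .id _ => .δ₀ r
  | _, _, _, .δ₁ r, .id _ => .δ₁ r

instance (V : Type v) : Category.{v} (NerveIndex V) where
  Hom := Hom
  id := Hom.id
  comp := Hom.comp
  id_comp _ := rfl
  comp_id f := by cases f <;> rfl
  assoc f g h := by cases f <;> cases g <;> rfl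

/-- `N` as a `V-cat`-category: the free one. -/
instance (V : Type v) [CompleteLattice V] [CommMonoid V] [IsQuantale V] :
    VCatCategory V (NerveIndex V) :=
  VCatCategory.free V (NerveIndex V)

end NerveIndex

/-- The unit `V`-category, with one object and hom `e`. -/
def VCat.unit (V : Type v) [CompleteLattice V] [CommMonoid V] : VCat.{v, u} V where
  carrier := PUnit
  hom _ _ := 1
  one_le_hom _ := le_rfl
  hom_mul_hom_le _ _ _ := by simp

/-- The `V`-functor from the unit `V`-category that picks an object. -/
def VCat.pick {V : Type v} [CompleteLattice V] [CommMonoid V] {X : VCat.{v, u} V} (x : X) :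
    VCat.unit.{v, u} V ⟶ X where
  toFun _ := x
  hom_le _ _ := X.one_le_hom x

section Nerve

variable (V : Type v) [CompleteLattice V] [CommMonoid V] [IsQuantale V]

/-- The weight on objects: `pt` is sent to the unit `V`-category and `r` to `2_r`. -/
def nerveWeightObj : NerveIndex V → VCat.{v, u} V
  | .pt => VCat.unit V
  | .lvl r => VCat.two r

/-- The weight on arrows: `δ₀` picks the object `0` and `δ₁` picks the object `1` of `2_r`. -/
def nerveWeightMap : {a b : NerveIndex V} → NerveIndex.Hom a b →
    (nerveWeightObj.{v, u} V b ⟶ nerveWeightObj.{v, u} V a)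
  | _, _, .id _ => 𝟙 _
  | _, _, .δ₀ r => VCat.pick (X := VCat.two r) ⟨false⟩
  | _, _, .δ₁ r => VCat.pick (X := VCat.two r) ⟨true⟩

/-- The weight `N : Nᵒᵖ → V-cat`. -/
def nerveWeight : VCatFunctor V (NerveIndex V)ᵒᵖ (VCat.{v, u} V) where
  obj a := nerveWeightObj V a.unop
  map f := nerveWeightMap V f.unop
  map_id _ := rfl
  map_comp {a b c} f g := by
    have key : ∀ {a b c : NerveIndex V} (f : NerveIndex.Hom a b) (g : NerveIndex.Hom b c),
        nerveWeightMap.{v, u} V (f.comp g) = nerveWeightMap V g ≫ nerveWeightMap V f := by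
      intro a b c f g
      cases f <;> cases g <;> rfl
    exact key g.unop f.unop
  homDist_le {a b} f g := by
    classical
    change (if f.unop = g.unop then (1 : V) else ⊥) ≤ _
    split_ifs with h
    · obtain rfl : f = g := Quiver.Hom.unop_inj h
      exact one_le_homDist _
    · exact bot_le

variable {V}

/-- The functor `F_X` on objects: `pt` is sent to the set of objects of `X` and `r` to
`X_r = {(x', x) | r ≤ X(x', x)}`. -/
def nerveDiagramObj (X : VCat.{v, u} V) : NerveIndex V → Type u
  | .pt => X.carrier
  | .lvl r => {p : X.carrier × X.carrier // r ≤ X.hom p.1 p.2}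

/-- The functor `F_X` on arrows: `δ₀` and `δ₁` are sent to the two projections. -/
def nerveDiagramMap (X : VCat.{v, u} V) : {a b : NerveIndex V} → NerveIndex.Hom a b →
    nerveDiagramObj X a → nerveDiagramObj X b
  | _, _, .id _ => fun x => x
  | _, _, .δ₀ _ => fun p => p.1.1
  | _, _, .δ₁ _ => fun p => p.1.2

/-- The functor `F_X : N → Set`. -/
def nerveDiagram (X : VCat.{v, u} V) : VCatFunctor V (NerveIndex V) (Type u) :=
  VCatFunctor.ofFree V
    { obj := nerveDiagramObj X
      map := fun f => TypeCat.ofHom (nerveDiagramMap X f)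
      map_id := fun _ => rfl
      map_comp := by
        have key : ∀ {a b c : NerveIndex V} (f : NerveIndex.Hom a b) (g : NerveIndex.Hom b c),
            nerveDiagramMap X (f.comp g) = nerveDiagramMap X g ∘ nerveDiagramMap X f := by
          intro a b c f g
          cases f <;> cases g <;> rfl
        intro a b c f g
        exact congrArg TypeCat.ofHom (key f g) }

/-- `G` is the `V-cat`-ification of `T : Set → Set`: it is a left Kan extension of `D T`
along `D`. -/
def IsVCatification (T : Type u ⥤ Type u)
    (G : VCatFunctor V (VCat.{v, u} V) (VCat.{v, u} V)) : Prop :=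
  ∃ α : ((VCatFunctor.ofFree V T : VCatFunctor V (Type u) (Type u)).comp
      (discreteFunctor V)).toFunctor ⟶ ((discreteFunctor V).comp G).toFunctor,
    IsLeftKanExtension (discreteFunctor V)
      ((VCatFunctor.ofFree V T : VCatFunctor V (Type u) (Type u)).comp (discreteFunctor V)) G α

/-- `G` preserves discrete `V`-categories. -/
def PreservesDiscrete (G : VCatFunctor V (VCat.{v, u} V) (VCat.{v, u} V)) : Prop :=
  ∀ X : VCat.{v, u} V, X.IsDiscrete → (G.obj X).IsDiscrete

end Nerve

end

noncomputable section

open VCatCategory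

/-! ### Descent along the two projections `X_r → X_o`. -/

section Codescent

variable {V : Type v} [CompleteLattice V] [CommMonoid V] [IsQuantale V]

/-! For fixed `H : Set → V-cat` and a `V`-category `X`, the colimit of `H` weighted by `V-cat(D -,
X)` and the colimit of `H F_X` weighted by `N` have the same universal property: each is a universal
`V`-functor out of `H X_o` among those that descend (`isWeightedColimit_homPresheaf_iff`,
`isWeightedColimit_nerveWeight_iff`). For the first weight, every `f : D S → X` factors through the
counit `D X_o → X`, and a pair `f, g` with hom `r` factors through the two projections of `X_r`. For
the second, a `V`-functor out of `2_r` is a pair of objects with hom at least `r`.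

For `H = D` the universal descending map is the counit `D X_o → X` itself. Hence preservation of the
nerve colimit at `X` says that `G` of the counit is universal for `H = G D`, while `α : H → G D` is
a Kan extension exactly when `α` followed by `G` of the counit is universal for `H`, for all `X`.
The two conditions agree as soon as `α` is invertible.

It remains to obtain an invertible `α : D T → G D`. Given a Kan extension, integrality makes every
map out of `H S` descend when `X` is discrete on `S`, so the identity is universal there and `α` is
invertible; thus `G` preserves discreteness. Conversely, if `G` preserves discreteness, then `G D ≅
D T` for `T` the underlying set functor of `G D`. -/

theorem VCat.homDist_le_comp_left {X Y Z : VCat.{v, u} V} (q : X ⟶ Y) (f g : Y ⟶ Z) :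
    homDist (V := V) f g ≤ homDist (V := V) (q ≫ f) (q ≫ g) :=
  le_iInf fun x => iInf_le _ (q.toFun x)

theorem VCat.homDist_le_comp_right {X Y Z : VCat.{v, u} V} (f g : X ⟶ Y) (k : Y ⟶ Z) :
    homDist (V := V) f g ≤ homDist (V := V) (f ≫ k) (g ≫ k) :=
  le_iInf fun x => (iInf_le _ x).trans (k.hom_le _ _)

/-- The counit of the discrete functor: the identity on objects. -/
def VCat.discCounit (X : VCat.{v, u} V) : (discreteFunctor V).obj X.carrier ⟶ X where
  toFun x := x
  hom_le x' x := by
    classical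
    change (if x' = x then (1 : V) else ⊥) ≤ X.hom x' x
    split_ifs with h
    · exact h ▸ X.one_le_hom x'
    · exact bot_le

/-- The map of sets underlying a `V`-functor out of a discrete `V`-category. -/
def VCat.discTranspose {S : Type u} {X : VCat.{v, u} V} (f : (discreteFunctor V).obj S ⟶ X) :
    S ⟶ X.carrier :=
  TypeCat.ofHom f.toFun

/-- The first projection `X_r → X_o`. -/
def VCat.levelFst (X : VCat.{v, u} V) (r : V) :
    (nerveDiagram X).obj (.lvl r) ⟶ X.carrier :=
  (nerveDiagram X).map (NerveIndex.Hom.δ₀ r)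

/-- The second projection `X_r → X_o`. -/
def VCat.levelSnd (X : VCat.{v, u} V) (r : V) :
    (nerveDiagram X).obj (.lvl r) ⟶ X.carrier :=
  (nerveDiagram X).map (NerveIndex.Hom.δ₁ r)

variable (H : VCatFunctor V (Type u) (VCat.{v, u} V)) (X : VCat.{v, u} V)

/-- A `V`-functor out of `H X_o` descends if, for each `r`, its restrictions along the two
projections `X_r → X_o` are at distance at least `r`. -/
def Descends {Y : VCat.{v, u} V} (h : H.obj X.carrier ⟶ Y) : Prop :=
  ∀ r : V, r ≤ homDist (V := V) (X := H.obj ((nerveDiagram X).obj (.lvl r)))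
    (H.map (X.levelFst r) ≫ h) (H.map (X.levelSnd r) ≫ h)

/-- `q : H X_o → Z` is universal among the `V`-functors that descend. -/
structure IsCodescent {Z : VCat.{v, u} V} (q : H.obj X.carrier ⟶ Z) : Prop where
  descends : Descends H X q
  homDist_comp {Y : VCat.{v, u} V} (k k' : Z ⟶ Y) :
    homDist (V := V) (q ≫ k) (q ≫ k') = homDist (V := V) k k'
  cancel {Y : VCat.{v, u} V} {k k' : Z ⟶ Y} : q ≫ k = q ≫ k' → k = k'
  exists_desc {Y : VCat.{v, u} V} (h : H.obj X.carrier ⟶ Y) : Descends H X h → ∃ k, q ≫ k = h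

variable {H X}

theorem Descends.comp {Y Z : VCat.{v, u} V} {h : H.obj X.carrier ⟶ Y} (hh : Descends H X h)
    (k : Y ⟶ Z) : Descends H X (h ≫ k) := fun r =>
  (hh r).trans (VCat.homDist_le_comp_right _ _ k)

/-- The projections of `X_r` are the universal pair of maps into `X` with hom at least `r`, so a
condition on them alone controls all pairs. -/
theorem Descends.homDist_le {Y : VCat.{v, u} V} {h : H.obj X.carrier ⟶ Y} (hh : Descends H X h)
    {S : Type u} (f g : (discreteFunctor V).obj S ⟶ X) :
    homDist (V := V) f g ≤ homDist (V := V) (H.map (VCat.discTranspose f) ≫ h)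
      (H.map (VCat.discTranspose g) ≫ h) := by
  -- With `r` the hom from `f` to `g` itself, each `(f s, g s)` lies in `X_r`.
  let r : V := homDist (V := V) f g
  let p : S ⟶ (nerveDiagram X).obj (.lvl r) :=
    TypeCat.ofHom fun s => (⟨(f.toFun s, g.toFun s), iInf_le _ s⟩ :
      {p : X.carrier × X.carrier // r ≤ X.hom p.1 p.2})
  have hf : VCat.discTranspose f = p ≫ X.levelFst r := rfl
  have hg : VCat.discTranspose g = p ≫ X.levelSnd r := rfl
  rw [hf, hg, H.map_comp, H.map_comp, Category.assoc, Category.assoc]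
  exact (hh r).trans (VCat.homDist_le_comp_left (H.map p) _ _)

/-- It suffices to test the two projections of `X_r`, viewed as `V`-functors `D X_r → X`: their hom
is at least `r` by the definition of `X_r`. -/
theorem descends_of_homDist_le {Y : VCat.{v, u} V} {h : H.obj X.carrier ⟶ Y}
    (hh : ∀ {S : Type u} (f g : (discreteFunctor V).obj S ⟶ X),
      homDist (V := V) f g ≤ homDist (V := V) (H.map (VCat.discTranspose f) ≫ h)
        (H.map (VCat.discTranspose g) ≫ h)) : Descends H X h := fun r => by
  refine le_trans ?_ (hh ((discreteFunctor V).map (X.levelFst r) ≫ X.discCounit)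
    ((discreteFunctor V).map (X.levelSnd r) ≫ X.discCounit))
  exact le_iInf fun p => p.2

/-- A weight whose transformations into `C(F -, Y)` are the `V`-functors `H X_o → Y` that descend
has as colimits of `F` the universal such `V`-functors. -/
theorem isWeightedColimit_iff_isCodescent {A : Type u₁} [Category.{w₁} A] [VCatCategory V A]
    {W : VCatFunctor V Aᵒᵖ (VCat.{v, u} V)} {F : VCatFunctor V A (VCat.{v, u} V)}
    (ev : ∀ {Y : VCat.{v, u} V}, (W.toFunctor ⟶ (homPresheaf F Y).toFunctor) →
      (H.obj X.carrier ⟶ Y))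
    (ev_injective : ∀ {Y : VCat.{v, u} V}, Function.Injective (ev (Y := Y)))
    (exists_ev_eq : ∀ {Y : VCat.{v, u} V} (h : H.obj X.carrier ⟶ Y),
      (∃ τ, ev τ = h) ↔ Descends H X h)
    (homDist_ev : ∀ {Y : VCat.{v, u} V} (τ τ' : W.toFunctor ⟶ (homPresheaf F Y).toFunctor),
      homDist (V := V) (ev τ) (ev τ') = (natTransObj W (homPresheaf F Y)).hom τ τ')
    (ev_comp : ∀ {Y Z : VCat.{v, u} V} (τ : W.toFunctor ⟶ (homPresheaf F Y).toFunctor)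
      (k : Y ⟶ Z), ev (τ ≫ homPresheafPostcomp F k) = ev τ ≫ k)
    {L : VCat.{v, u} V} (η : W.toFunctor ⟶ (homPresheaf F L).toFunctor) :
    IsWeightedColimit W F L η ↔ IsCodescent H X (ev η) := by
  constructor
  · intro hη
    refine ⟨(exists_ev_eq _).1 ⟨η, rfl⟩, fun {Y} k k' => ?_, fun {Y} k k' h => ?_,
      fun {Y} h hh => ?_⟩
    · rw [← ev_comp, ← ev_comp, homDist_ev]
      exact (hη Y).2 k k'
    · rw [← ev_comp, ← ev_comp] at h
      exact (hη Y).1.1 (ev_injective h)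
    · obtain ⟨τ, rfl⟩ := (exists_ev_eq h).2 hh
      obtain ⟨k, hk⟩ := (hη Y).1.2 τ
      exact ⟨k, (ev_comp η k).symm.trans (congrArg ev hk)⟩
  · intro hη Y
    refine ⟨⟨fun (k k' : L ⟶ Y) h => hη.cancel ?_, fun τ => ?_⟩, fun (k k' : L ⟶ Y) => ?_⟩
    · rw [← ev_comp, ← ev_comp]
      exact congrArg ev h
    · obtain ⟨k, hk⟩ := hη.exists_desc (ev τ) ((exists_ev_eq _).1 ⟨τ, rfl⟩)
      exact ⟨k, ev_injective (by rw [← hk, ← ev_comp])⟩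
    · refine Eq.trans ?_ (hη.homDist_comp k k')
      rw [← ev_comp, ← ev_comp]
      exact (homDist_ev _ _).symm

/-! ### The two weights -/

/-! ### Transformations out of either weight as descending `V`-functors. -/

/-- A Yoneda argument: `f` is the counit restricted along its transpose, so naturality determines
`τ` by its value at the counit. -/
theorem app_discreteFunctor_eq {Y : VCat.{v, u} V}
    (τ : (homPresheaf (discreteFunctor V) X).toFunctor ⟶ (homPresheaf H Y).toFunctor)
    {S : Type u} (f : (discreteFunctor V).obj S ⟶ X) :
    (τ.app (op S)).toFun f =
      H.map (VCat.discTranspose f) ≫ (τ.app (op X.carrier)).toFun X.discCounit :=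
  congrFun (congrArg VFunctor.toFun (τ.naturality (VCat.discTranspose f).op)) X.discCounit

/-- Colimits weighted by `V-cat(D -, X)` are universal descending `V`-functors. -/
theorem isWeightedColimit_homPresheaf_iff {L : VCat.{v, u} V}
    (τ : (homPresheaf (discreteFunctor V) X).toFunctor ⟶ (homPresheaf H L).toFunctor) :
    IsWeightedColimit (homPresheaf (discreteFunctor V) X) H L τ ↔
      IsCodescent H X ((τ.app (op X.carrier)).toFun X.discCounit) := by
  refine isWeightedColimit_iff_isCodescent
    (ev := fun {Y} τ => (τ.app (op X.carrier)).toFun X.discCounit) ?_ ?_ ?_ ?_ τ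
  · intro Y τ τ' h
    refine NatTrans.ext (funext fun S => VFunctor.ext (funext fun f => ?_))
    refine (app_discreteFunctor_eq τ f).trans (Eq.trans ?_ (app_discreteFunctor_eq τ' f).symm)
    exact congrArg (_ ≫ ·) h
  · intro Y h
    constructor
    · rintro ⟨τ, rfl⟩
      refine descends_of_homDist_le fun {S} f g => ?_
      have := (τ.app (op S)).hom_le f g
      rw [app_discreteFunctor_eq τ f, app_discreteFunctor_eq τ g] at this
      exact this
    · intro hh
      refine ⟨{ app := fun S =>
                  { toFun := fun f => H.map (VCat.discTranspose f) ≫ h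
                    hom_le := fun f g => hh.homDist_le f g }
                naturality := fun S S' p => VFunctor.ext (funext fun f => ?_) }, ?_⟩
      · change H.map (p.unop ≫ VCat.discTranspose f) ≫ h =
          H.map p.unop ≫ H.map (VCat.discTranspose f) ≫ h
        rw [H.map_comp, Category.assoc]
      · change H.map (𝟙 X.carrier) ≫ h = h
        rw [H.map_id, Category.id_comp]
  · intro Y τ τ'
    -- Restriction never decreases homs, so the infimum over all `S` and `f` is attained at the
    -- counit.
    refine le_antisymm (le_iInf fun S => le_iInf fun f => ?_) ?_
    · rw [app_discreteFunctor_eq τ (S := S.unop) f, app_discreteFunctor_eq τ' (S := S.unop) f]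
      exact VCat.homDist_le_comp_left (H.map (VCat.discTranspose f)) _ _
    · exact (iInf_le _ (op X.carrier)).trans (iInf_le _ X.discCounit)
  · intros; rfl

/-- Object `0` of `2_r` is the image of the point under `N δ₀`; with the analogous fact for `1`,
naturality determines `τ` by its value at the point. -/
theorem nerveWeight_app_false {Y : VCat.{v, u} V} (τ : (nerveWeight.{v, u} V).toFunctor ⟶
    (homPresheaf ((nerveDiagram X).comp H) Y).toFunctor) (r : V) :
    (τ.app (op (.lvl r))).toFun ⟨false⟩ =
      H.map (X.levelFst r) ≫ (τ.app (op .pt)).toFun PUnit.unit :=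
  congrFun (congrArg VFunctor.toFun
    (τ.naturality (Quiver.Hom.op (V := NerveIndex V) (NerveIndex.Hom.δ₀ r)))) PUnit.unit

theorem nerveWeight_app_true {Y : VCat.{v, u} V} (τ : (nerveWeight.{v, u} V).toFunctor ⟶
    (homPresheaf ((nerveDiagram X).comp H) Y).toFunctor) (r : V) :
    (τ.app (op (.lvl r))).toFun ⟨true⟩ =
      H.map (X.levelSnd r) ≫ (τ.app (op .pt)).toFun PUnit.unit :=
  congrFun (congrArg VFunctor.toFun
    (τ.naturality (Quiver.Hom.op (V := NerveIndex V) (NerveIndex.Hom.δ₁ r)))) PUnit.unit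

/-- The value at the point forces the images of `0` and `1` at level `r`. The only nontrivial hom
condition is the one from `0` to `1`, which is descent at `r`. -/
theorem exists_nerveWeight_app_eq_iff {Y : VCat.{v, u} V} (h : H.obj X.carrier ⟶ Y) :
    (∃ τ : (nerveWeight.{v, u} V).toFunctor ⟶
      (homPresheaf ((nerveDiagram X).comp H) Y).toFunctor,
        (τ.app (op .pt)).toFun PUnit.unit = h) ↔ Descends H X h := by
  constructor
  · rintro ⟨τ, rfl⟩ r
    have := (τ.app (op (.lvl r))).hom_le ⟨false⟩ ⟨true⟩
    rw [nerveWeight_app_false τ, nerveWeight_app_true τ] at this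
    exact this
  · intro hh
    let σ : ∀ a : NerveIndex V, nerveWeightObj.{v, u} V a ⟶
        homObj V (((nerveDiagram X).comp H).obj a) Y := fun a =>
      match a with
      | .pt => VCat.pick (X := homObj V (H.obj X.carrier) Y) h
      | .lvl r =>
        { toFun := fun x => match x with
            | ⟨false⟩ => H.map (X.levelFst r) ≫ h
            | ⟨true⟩ => H.map (X.levelSnd r) ≫ h
          hom_le := by
            rintro ⟨_ | _⟩ ⟨_ | _⟩
            · exact one_le_homDist _
            · exact hh r
            · exact bot_le
            · exact one_le_homDist _ }
    have nat : ∀ {a b : NerveIndex V} (p : NerveIndex.Hom a b) (x : nerveWeightObj.{v, u} V b),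
        (σ a).toFun ((nerveWeightMap V p).toFun x) =
          H.map ((nerveDiagram X).map (show a ⟶ b from p)) ≫ (σ b).toFun x := by
      intro a b p x
      cases p with
      | id a =>
        change (σ a).toFun x = H.map ((nerveDiagram X).map (𝟙 a)) ≫ (σ a).toFun x
        rw [(nerveDiagram X).map_id, H.map_id]
        exact (Category.id_comp (obj := VCat.{v, u} V) _).symm
      | δ₀ r => rfl
      | δ₁ r => rfl
    exact ⟨{ app := fun a => σ a.unop
             naturality := fun a b p => VFunctor.ext (funext fun x => nat p.unop x) }, rfl⟩

/-- Colimits weighted by the nerve weight are universal descending `V`-functors. -/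
theorem isWeightedColimit_nerveWeight_iff {L : VCat.{v, u} V}
    (η : (nerveWeight.{v, u} V).toFunctor ⟶ (homPresheaf ((nerveDiagram X).comp H) L).toFunctor) :
    IsWeightedColimit (nerveWeight.{v, u} V) ((nerveDiagram X).comp H) L η ↔
      IsCodescent H X ((η.app (op .pt)).toFun PUnit.unit) := by
  refine isWeightedColimit_iff_isCodescent (H := H) (X := X)
    (W := nerveWeight.{v, u} V) (F := (nerveDiagram X).comp H)
    (ev := fun {Y} τ => (τ.app (op NerveIndex.pt)).toFun PUnit.unit) ?_ ?_ ?_ ?_ η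
  · intro Y τ τ' h
    refine NatTrans.ext (funext fun a => VFunctor.ext (funext fun x => ?_))
    obtain ⟨_ | r⟩ := a
    · exact h
    · obtain ⟨_ | _⟩ := x
      · exact (nerveWeight_app_false τ r).trans (Eq.trans (congrArg (_ ≫ ·) h) (nerveWeight_app_false τ' r).symm)
      · exact (nerveWeight_app_true τ r).trans (Eq.trans (congrArg (_ ≫ ·) h) (nerveWeight_app_true τ' r).symm)
  · intro Y h
    exact exists_nerveWeight_app_eq_iff h
  · intro Y τ τ'
    refine le_antisymm (le_iInf fun a => le_iInf fun x => ?_)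
      ((iInf_le _ (op NerveIndex.pt)).trans (iInf_le _ PUnit.unit))
    obtain ⟨_ | r⟩ := a
    · exact le_rfl
    · obtain ⟨_ | _⟩ := x
      · rw [nerveWeight_app_false τ, nerveWeight_app_false τ']
        exact VCat.homDist_le_comp_left (H.map (X.levelFst r)) _ _
      · rw [nerveWeight_app_true τ, nerveWeight_app_true τ']
        exact VCat.homDist_le_comp_left (H.map (X.levelSnd r)) _ _
  · intros; rfl

end Codescent

/-! ### Transport along isomorphisms. -/

theorem VCat.hom_iso {V : Type v} [CompleteLattice V] [CommMonoid V] {X Y : VCat.{v, u} V} (e : X ≅ Y) (x' x : X) :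
    Y.hom (e.hom.toFun x') (e.hom.toFun x) = X.hom x' x := by
  refine le_antisymm ((e.inv.hom_le _ _).trans_eq ?_) (e.hom.hom_le x' x)
  have h (z : X) : e.inv.toFun (e.hom.toFun z) = z :=
    congrFun (congrArg VFunctor.toFun e.hom_inv_id) z
  rw [h, h]

theorem VCat.IsDiscrete.of_iso {V : Type v} [CompleteLattice V] [CommMonoid V]
    {X Y : VCat.{v, u} V} (hX : X.IsDiscrete) (e : X ≅ Y) : Y.IsDiscrete := by
  refine ⟨fun y => (VCat.hom_iso e.symm y y).symm.trans (hX.1 _), fun y' y h =>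
    (VCat.hom_iso e.symm y' y).symm.trans (hX.2 _ _ fun h' => h ?_)⟩
  have h (z : Y) : e.hom.toFun (e.inv.toFun z) = z :=
    congrFun (congrArg VFunctor.toFun e.inv_hom_id) z
  exact (h y').symm.trans ((congrArg e.hom.toFun h').trans (h y))

section Preservation

variable {V : Type v} [CompleteLattice V] [CommMonoid V] [IsQuantale V]
variable {H : VCatFunctor V (Type u) (VCat.{v, u} V)} {X : VCat.{v, u} V}

namespace IsCodescent

theorem comp_iso {Z Z' : VCat.{v, u} V} {q : H.obj X.carrier ⟶ Z} (hq : IsCodescent H X q)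
    (e : Z ≅ Z') : IsCodescent H X (q ≫ e.hom) where
  descends := hq.descends.comp e.hom
  homDist_comp k k' := by
    rw [Category.assoc, Category.assoc, hq.homDist_comp]
    refine le_antisymm ?_ (VCat.homDist_le_comp_left e.hom k k')
    simpa using VCat.homDist_le_comp_left e.inv (e.hom ≫ k) (e.hom ≫ k')
  cancel h := by
    rw [Category.assoc, Category.assoc] at h
    exact (cancel_epi e.hom).1 (hq.cancel h)
  exists_desc h hh := by
    obtain ⟨k, hk⟩ := hq.exists_desc h hh
    exact ⟨e.inv ≫ k, by simpa using hk⟩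

theorem exists_iso {Z Z' : VCat.{v, u} V} {q : H.obj X.carrier ⟶ Z}
    {q' : H.obj X.carrier ⟶ Z'} (hq : IsCodescent H X q) (hq' : IsCodescent H X q') :
    ∃ e : Z ≅ Z', q ≫ e.hom = q' := by
  obtain ⟨k, hk⟩ := hq.exists_desc q' hq'.descends
  obtain ⟨k', hk'⟩ := hq'.exists_desc q hq.descends
  refine ⟨⟨k, k', hq.cancel ?_, hq'.cancel ?_⟩, hk⟩
  · rw [← Category.assoc, hk, hk', Category.comp_id]
  · rw [← Category.assoc, hk', hk, Category.comp_id]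

end IsCodescent

theorem Descends.precomp {H' : VCatFunctor V (Type u) (VCat.{v, u} V)}
    (α : H.toFunctor ⟶ H'.toFunctor) {Y : VCat.{v, u} V} {h : H'.obj X.carrier ⟶ Y}
    (hh : Descends H' X h) : Descends H X (α.app X.carrier ≫ h) := fun r => by
  rw [α.naturality_assoc, α.naturality_assoc]
  exact (hh r).trans (VCat.homDist_le_comp_left _ _ _)

/-- Allows `G D` and `D T` to be exchanged, in both directions of the theorem. -/
theorem IsCodescent.iso_comp {H' : VCatFunctor V (Type u) (VCat.{v, u} V)}
    (α : H.toFunctor ≅ H'.toFunctor) {Z : VCat.{v, u} V} {q : H'.obj X.carrier ⟶ Z}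
    (hq : IsCodescent H' X q) : IsCodescent H X (α.hom.app X.carrier ≫ q) where
  descends := hq.descends.precomp α.hom
  homDist_comp k k' := by
    rw [← hq.homDist_comp, Category.assoc, Category.assoc]
    refine le_antisymm ?_ (VCat.homDist_le_comp_left _ _ _)
    simpa using VCat.homDist_le_comp_left (α.inv.app X.carrier)
      (α.hom.app X.carrier ≫ q ≫ k) (α.hom.app X.carrier ≫ q ≫ k')
  cancel h := by
    rw [Category.assoc, Category.assoc] at h
    exact hq.cancel ((cancel_epi (α.hom.app X.carrier)).1 h)
  exists_desc h hh := by
    obtain ⟨k, hk⟩ := hq.exists_desc _ (hh.precomp α.inv)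
    exact ⟨k, by rw [Category.assoc, hk, Iso.hom_inv_id_app_assoc]⟩

/-! ### Codescent for the discrete functor and over discrete `V`-categories. -/

/-- Every `V`-category is the codescent object of its own nerve. -/
theorem isCodescent_discCounit (X : VCat.{v, u} V) :
    IsCodescent (discreteFunctor V) X X.discCounit where
  descends r := le_iInf fun p => p.2
  homDist_comp _ _ := rfl
  cancel h := by
    have := congrArg VFunctor.toFun h
    exact VFunctor.ext this
  -- Descent at level `r = X(x', x)`, evaluated at the element `(x', x)` of `X_r`, is the
  -- `V`-functor inequality for that pair.
  exists_desc h hh := ⟨⟨h.toFun, fun x' x => (hh (X.hom x' x)).trans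
    (iInf_le _ (⟨(x', x), le_rfl⟩ : {p : X.carrier × X.carrier // X.hom x' x ≤ X.hom p.1 p.2}))⟩,
    rfl⟩

/-- Distinct objects have hom `⊥`, so for `r ≠ ⊥` only diagonal pairs lie in level `r`. -/
theorem VCat.levelFst_disc_eq {S : Type u} {r : V} (hr : r ≠ ⊥) :
    (VCat.disc V S).levelFst r = (VCat.disc V S).levelSnd r := by
  classical
  refine congrArg TypeCat.ofHom (funext ?_)
  rintro ⟨⟨x', x⟩, hp⟩
  by_contra hne
  refine hr (le_bot_iff.1 (hp.trans (le_of_eq (if_neg ?_))))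
  exact hne

/-- In an integral quantale, every `V`-functor out of `H S` descends along the nerve of the
discrete `V`-category on `S`. -/
theorem isCodescent_id_disc (integral : (1 : V) = ⊤)
    (H : VCatFunctor V (Type u) (VCat.{v, u} V)) (S : Type u) :
    IsCodescent H (VCat.disc V S) (𝟙 (H.obj S)) where
  descends r := by
    by_cases hr : r = ⊥
    · subst hr; exact bot_le
    · rw [VCat.levelFst_disc_eq hr]
      -- The two restrictions coincide, so their hom is at least `e`; integrality puts every `r`
      -- below `e`.
      exact (le_top.trans integral.ge).trans (one_le_homDist _)
  homDist_comp _ _ := rfl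
  cancel h := h
  exists_desc h _ := ⟨h, rfl⟩

theorem VCat.disc_isDiscrete (S : Type u) : (VCat.disc V S).IsDiscrete :=
  ⟨fun _ => if_pos rfl, fun _ _ h => if_neg h⟩

/-- An equality rather than an isomorphism, so that it can be rewritten under `G`. -/
theorem VCat.IsDiscrete.eq_disc {X : VCat.{v, u} V} (hX : X.IsDiscrete) :
    X = VCat.disc V X.carrier := by
  obtain ⟨C, hom, h₁, h₂⟩ := X
  obtain rfl : hom = (VCat.disc V C).hom := by
    funext x' x
    by_cases h : x' = x
    · subst h
      exact (hX.1 x').trans ((VCat.disc_isDiscrete C).1 x').symm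
    · exact (hX.2 x' x h).trans ((VCat.disc_isDiscrete C).2 x' x h).symm
  rfl

theorem VCat.IsDiscrete.isIso_discCounit {X : VCat.{v, u} V} (hX : X.IsDiscrete) :
    IsIso X.discCounit := by
  refine ⟨⟨⟨fun x => x, fun x' x => ?_⟩, rfl, rfl⟩⟩
  change X.hom x' x ≤ (VCat.disc V X.carrier).hom x' x
  by_cases h : x' = x
  · subst h
    rw [hX.1]
    exact VCat.one_le_hom _ _
  · rw [hX.2 _ _ h]
    exact bot_le

/-- The underlying set functor of a functor into `V`-categories. -/
def VCatFunctor.carrierFunctor (H : VCatFunctor V (Type u) (VCat.{v, u} V)) :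
    Type u ⥤ Type u where
  obj S := (H.obj S).carrier
  map f := TypeCat.ofHom (H.map f).toFun
  map_id S := by rw [H.map_id]; rfl
  map_comp f g := by rw [H.map_comp]; rfl

/-- The comparison `D T → H`, for `T` the underlying set functor of `H`. -/
def VCatFunctor.discCarrierCounit (H : VCatFunctor V (Type u) (VCat.{v, u} V)) :
    ((VCatFunctor.ofFree V H.carrierFunctor : VCatFunctor V (Type u) (Type u)).comp
      (discreteFunctor V)).toFunctor ⟶ H.toFunctor where
  app S := (H.obj S).discCounit
  naturality _ _ _ := rfl

/-! ### Nerve colimits and Kan extensions in terms of codescent. -/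

variable {G : VCatFunctor V (VCat.{v, u} V) (VCat.{v, u} V)}

/-- The counit exhibits `X` as the nerve colimit, and every other colimit differs from it by an
isomorphism, which `G` preserves. Testing this one colimit is therefore enough. -/
theorem preservesWeightedColimit_nerveWeight_iff (X : VCat.{v, u} V) :
    PreservesWeightedColimit G (nerveWeight.{v, u} V) ((nerveDiagram X).comp (discreteFunctor V)) ↔
      IsCodescent ((discreteFunctor V).comp G) X (G.map X.discCounit) := by
  constructor
  · intro hG
    obtain ⟨η, hη⟩ := (exists_nerveWeight_app_eq_iff X.discCounit).2
      (isCodescent_discCounit X).descends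
    have h := hG X η ((isWeightedColimit_nerveWeight_iff η).2
      (hη.symm ▸ isCodescent_discCounit X))
    have h' := (isWeightedColimit_nerveWeight_iff (H := (discreteFunctor V).comp G) _).1 h
    rw [← hη]
    exact h'
  · intro hG L η hη
    obtain ⟨e, he⟩ := (isCodescent_discCounit X).exists_iso
      ((isWeightedColimit_nerveWeight_iff η).1 hη)
    refine (isWeightedColimit_nerveWeight_iff (H := (discreteFunctor V).comp G) _).2 ?_
    change IsCodescent ((discreteFunctor V).comp G) X (G.map ((η.app (op NerveIndex.pt)).toFun PUnit.unit))
    rw [← he, G.map_comp]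
    exact hG.comp_iso (G.mapIso e)

theorem isLeftKanExtension_discreteFunctor_iff
    (α : H.toFunctor ⟶ ((discreteFunctor V).comp G).toFunctor) :
    IsLeftKanExtension (discreteFunctor V) H G α ↔
      ∀ X : VCat.{v, u} V, IsCodescent H X (α.app X.carrier ≫ G.map X.discCounit) :=
  forall_congr' fun _ => isWeightedColimit_homPresheaf_iff _

/-- The unit of a left Kan extension along the discrete functor is invertible. -/
theorem IsLeftKanExtension.isIso_app (integral : (1 : V) = ⊤)
    {α : H.toFunctor ⟶ ((discreteFunctor V).comp G).toFunctor}
    (hα : IsLeftKanExtension (discreteFunctor V) H G α) (S : Type u) : IsIso (α.app S) := by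
  have h := (isLeftKanExtension_discreteFunctor_iff α).1 hα (VCat.disc V S)
  obtain ⟨e, he⟩ := (isCodescent_id_disc integral H S).exists_iso h
  have : e.hom = α.app S := by
    refine he.trans ?_
    -- The counit of a discrete `V`-category is definitionally the identity, so the universal map at
    -- `D S` is `α` alone.
    exact (congrArg (α.app S ≫ ·) (G.map_id (VCat.disc V S))).trans (Category.comp_id _)
  rw [← this]
  exact e.isIso_hom

end Preservation

end

theorem theorem3p17 (V : Type v) [CompleteLattice V] [CommMonoid V] [IsQuantale V] [Nontrivial V]
    (integral : (1 : V) = ⊤) (G : VCatFunctor V (VCat.{v, u} V) (VCat.{v, u} V)) :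
    (∃ T : Type u ⥤ Type u, IsVCatification T G) ↔
      (∀ X : VCat.{v, u} V, PreservesWeightedColimit G (nerveWeight.{v, u} V)
        ((nerveDiagram X).comp (discreteFunctor V))) ∧
      PreservesDiscrete G := by
  constructor
  · rintro ⟨T, α, hα⟩
    have hiso := hα.isIso_app integral
    refine ⟨fun X => (preservesWeightedColimit_nerveWeight_iff X).2 ?_, fun X hX => ?_⟩
    · have := NatIso.isIso_of_isIso_app α
      have h := ((isLeftKanExtension_discreteFunctor_iff α).1 hα X).iso_comp (asIso α).symm
      -- Transport along the inverse of `α` cancels the factor `α`, leaving `G` of the counit.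
      exact (congrArg (IsCodescent ((discreteFunctor V).comp G) X)
        ((asIso α).inv_hom_id_app_assoc X.carrier (G.map X.discCounit))).mp h
    · rw [hX.eq_disc]
      exact (VCat.disc_isDiscrete (T.obj X.carrier)).of_iso (@asIso _ _ _ _ _ (hiso X.carrier))
  · rintro ⟨hG, hD⟩
    -- The required `T` is the underlying set functor of `G D`; since each `G D S` is discrete, the
    -- identity-on-objects comparison `D T → G D` is invertible.
    let H : VCatFunctor V (Type u) (VCat.{v, u} V) := (discreteFunctor V).comp G
    have hiso (S : Type u) : IsIso (H.discCarrierCounit.app S) :=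
      (hD (VCat.disc V S) (VCat.disc_isDiscrete S)).isIso_discCounit
    have := NatIso.isIso_of_isIso_app H.discCarrierCounit
    exact ⟨H.carrierFunctor, H.discCarrierCounit,
      (isLeftKanExtension_discreteFunctor_iff _).2 fun X =>
        ((preservesWeightedColimit_nerveWeight_iff X).1 (hG X)).iso_comp
          (asIso H.discCarrierCounit)⟩
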